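/- Let $r$ and $m$ be positive integers and let $p>7$ be a prime with $p\nmid m$. Let $B_k$ denote the Bernoulli numbers, defined by $\frac{t}{e^t-1}=\sum_{k\ge 0}B_k\frac{t^k}{k!}$. For rational numbers $a,b$, write $a\equiv b \pmod{p^r}$ if $a-b=p^r c$ for some rational number $c$ whose reduced denominator is not divisible by $p$. (i) If $r=1$, then $$\sum_{\substack{l_1+l_2+\dots+l_7=mp\\ l_1,\dots,l_7>0,\ p\nmid l_1,\dots,p\nmid l_7}}\frac{1}{l_1l_2\cdots l_7}\equiv -(504m+210m^3+6m^5)\,B_{p-7}\pmod{p}.$$ (ii) If $r\ge 2$, then $$\sum_{\substack{l_1+l_2+\dots+l_7=mp^r\\ l_1,\dots,l_7>0,\ p\nmid l_1,\dots,p\nmid l_7}}\frac{1}{l_1l_2\cdots l_7}\equiv -\frac{7!}{10}\,m\,p^{r-1}B_{p-7}\pmod{p^r}.$$ Here both sums run over all 7-tuples of positive integers satisfying the displayed conditions. -/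

import Mathlib

/-- Congruence of rational numbers modulo `p ^ r`: the difference `a - b` is `p ^ r` times a
rational number whose reduced denominator is not divisible by `p`. -/
def RatCongr (p r : ℕ) (a b : ℚ) : Prop :=
  ∃ c : ℚ, ¬ p ∣ c.den ∧ a - b = (p : ℚ) ^ r * c

/-- The sum of `1 / (l₁ ⋯ l_d)` over all `d`-tuples of positive integers, none of them divisible
by `p`, with `l₁ + ⋯ + l_d = N`. -/
def recipSum (p d N : ℕ) : ℚ :=
  ∑ l ∈ (Finset.Nat.antidiagonalTuple d N).filter (fun l => ∀ i, 0 < l i ∧ ¬ p ∣ l i),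
    1 / ∏ i, (l i : ℚ)

/-! Let `v l` be the inverse of `l` if `p ∤ l` and `0` otherwise. The sum is the coefficient of `X ^
N` in `mk v ^ 7`, and everything is computed with `v` valued in `ℤ_[p]`.

Let `q` be a positive power of `p`, and let `g` be the truncation of `mk v` below degree `q`. Modulo
`q`, `v` is `q`-periodic, so `mk v = g / (1 - X ^ q)`, and the coefficient at `M * q` is a
combination of the six block coefficients `[X ^ (k * q)] g ^ 7` with weights `choose (M + 6 - k) 6`.
Modulo `p * q` there is one first-order correction, which vanishes when `p ∣ M` by Lucas
(`coeff_mk_pow_seven_mul_prime`).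

For `q = p`, `g` modulo `p` is the truncated logarithm `L = ∑ X ^ l / l`. The symmetries `X ↦ 1 / X`
and `X ↦ 1 - X` determine all block coefficients of `L ^ 7` from the first
(`blockCoeff_eq_blockRatio_mul`), which power sums and Faulhaber's formula evaluate as `-720 *
B_{p-7}` (`blockCoeff_one_eq`). This gives the case `r = 1`.

For `r ≥ 2`, the weights with `M = m * p` are divisible by `p` and linear in `m` to the next order,
so block coefficients modulo `q` yield sums modulo `p * q`. Inverting the weights recovers the block
coefficients at the next level, and the constant `-504 = -7! / 10` reproduces itself
(`pow_dvd_coeff_mk_pow_seven`). -/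

/-! ### Power series and the block expansion -/

open PowerSeries in
theorem coeff_mk_pow_eq_sum_antidiagonalTuple {A : Type*} [CommSemiring A] (v : ℕ → A) (d N : ℕ) :
    coeff N (mk v ^ d) = ∑ l ∈ Finset.Nat.antidiagonalTuple d N, ∏ i, v (l i) := by
  have h := coeff_prod (fun _ : Fin d => mk v) N Finset.univ
  rw [Finset.prod_const, Finset.card_univ, Fintype.card_fin] at h
  rw [h]
  refine Finset.sum_bij' (fun l _ => (l : Fin d → ℕ)) (fun l _ => Finsupp.equivFunOnFinite.symm l)
    ?_ ?_ ?_ ?_ ?_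
  · intro l hl
    rw [Finset.Nat.mem_antidiagonalTuple]
    exact (Finset.mem_finsuppAntidiag.1 hl).1
  · intro l hl
    rw [Finset.mem_finsuppAntidiag]
    exact ⟨by simpa using Finset.Nat.mem_antidiagonalTuple.1 hl, by simp⟩
  · intro l hl; simp
  · intro l hl; simp
  · intro l hl; simp

open PowerSeries in
theorem coeff_mul_expand {A : Type*} [CommRing A] (q : ℕ) (hq : q ≠ 0) (F w : A⟦X⟧) (n : ℕ) :
    coeff n (F * expand q hq w) =
      ∑ j ∈ Finset.range (n / q + 1), coeff (n - j * q) F * coeff j w := by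
  have hinj : Set.InjOn (fun j => j * q) (Finset.range (n / q + 1) : Set ℕ) :=
    fun a _ b _ h => Nat.eq_of_mul_eq_mul_right (Nat.pos_of_ne_zero hq) h
  rw [mul_comm, coeff_mul, Finset.Nat.sum_antidiagonal_eq_sum_range_succ
    (fun i j => coeff i (expand q hq w) * coeff j F)]
  have h1 : ∑ j ∈ Finset.range (n / q + 1), coeff (n - j * q) F * coeff j w =
      ∑ k ∈ (Finset.range (n / q + 1)).image (fun j => j * q),
        coeff k (expand q hq w) * coeff (n - k) F := by
    rw [Finset.sum_image hinj]
    refine Finset.sum_congr rfl fun j _ => ?_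
    rw [mul_comm j q, coeff_expand_mul, mul_comm]
  rw [h1]
  symm
  refine Finset.sum_subset ?_ ?_
  · intro k hk
    obtain ⟨j, hj, rfl⟩ := Finset.mem_image.1 hk
    rw [Finset.mem_range] at hj ⊢
    have := Nat.mul_le_of_le_div q j n (by omega)
    omega
  · intro k hk hk'
    rw [coeff_expand_of_not_dvd, zero_mul]
    rintro ⟨c, rfl⟩
    apply hk'
    rw [Finset.mem_image]
    refine ⟨c, ?_, mul_comm _ _⟩
    rw [Finset.mem_range] at hk ⊢
    have : c ≤ n / q := by
      rw [Nat.le_div_iff_mul_le (Nat.pos_of_ne_zero hq), mul_comm]; omega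
    omega

open PowerSeries in
theorem coeff_trunc_mul_expand {A : Type*} [CommRing A] (q : ℕ) (hq : q ≠ 0) (f w : A⟦X⟧)
    (n : ℕ) :
    coeff n ((trunc q f : A⟦X⟧) * expand q hq w) = coeff (n % q) f * coeff (n / q) w := by
  have hq' := Nat.pos_of_ne_zero hq
  rw [coeff_mul_expand, Finset.sum_eq_single (n / q)]
  · rw [Polynomial.coeff_coe, coeff_trunc]
    have : n - n / q * q = n % q := by
      have := Nat.div_add_mod' n q; omega
    rw [this, if_pos (Nat.mod_lt _ hq')]
  · intro j hj hne
    rw [Polynomial.coeff_coe, coeff_trunc, if_neg, zero_mul]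
    rw [Finset.mem_range] at hj
    have h1 : (j + 1) * q ≤ n / q * q := Nat.mul_le_mul_right q (by omega)
    have := Nat.div_mul_le_self n q
    rw [add_mul] at h1
    omega
  · intro h; simp at h

/-- The coefficient of `X ^ (k * q)` in the seventh power of the truncation at degree `q` of the
power series with coefficients `v`. -/
noncomputable def blockCoeff {A : Type*} [CommRing A] (v : ℕ → A) (q k : ℕ) : A :=
  (PowerSeries.trunc q (PowerSeries.mk v) ^ 7).coeff (k * q)

/-- `v` is the reciprocal function on the integers prime to `p`, extended by zero. -/
structure IsPrimeToInv {A : Type*} [CommRing A] (p : ℕ) (v : ℕ → A) : Prop where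
  zero_of_dvd : ∀ l, p ∣ l → v l = 0
  mul_eq_one : ∀ l, ¬ p ∣ l → (l : A) * v l = 1

theorem IsPrimeToInv.map {A B : Type*} [CommRing A] [CommRing B] {p : ℕ} {v : ℕ → A}
    (h : IsPrimeToInv p v) (φ : A →+* B) : IsPrimeToInv p (fun l => φ (v l)) where
  zero_of_dvd l hl := by rw [h.zero_of_dvd l hl, map_zero]
  mul_eq_one l hl := by rw [← map_natCast φ, ← map_mul, h.mul_eq_one l hl, map_one]

theorem coeff_mk_pow_map {A B : Type*} [CommRing A] [CommRing B] (v : ℕ → A)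
    (φ : A →+* B) (d N : ℕ) :
    PowerSeries.coeff N (PowerSeries.mk (fun l => φ (v l)) ^ d) =
      φ (PowerSeries.coeff N (PowerSeries.mk v ^ d)) := by
  simp only [coeff_mk_pow_eq_sum_antidiagonalTuple, map_sum, map_prod]

theorem blockCoeff_map {A B : Type*} [CommRing A] [CommRing B] (v : ℕ → A)
    (φ : A →+* B) (q k : ℕ) : blockCoeff (fun l => φ (v l)) q k = φ (blockCoeff v q k) := by
  have : PowerSeries.trunc q (PowerSeries.mk (fun l => φ (v l))) =
      (PowerSeries.trunc q (PowerSeries.mk v)).map φ := by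
    ext n
    simp only [PowerSeries.coeff_trunc, Polynomial.coeff_map, PowerSeries.coeff_mk]
    split_ifs <;> simp
  rw [blockCoeff, this, ← Polynomial.map_pow, Polynomial.coeff_map, blockCoeff]

/-- First-order expansion of `1 / (l + a * q)`, exact because `q ^ 2 = 0`. -/
theorem IsPrimeToInv.apply_mul_add {A : Type*} [CommRing A] {p : ℕ} {v : ℕ → A}
    (h : IsPrimeToInv p v) {q : ℕ} (hpq : p ∣ q) (hq : (q : A) ^ 2 = 0) (a l : ℕ) :
    v (a * q + l) = v l - a * q * v l ^ 2 := by
  by_cases hl : p ∣ l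
  · rw [h.zero_of_dvd l hl, h.zero_of_dvd _ (dvd_add (hpq.mul_left a) hl)]; ring
  · have h1 := h.mul_eq_one l hl
    have h2 := h.mul_eq_one (a * q + l) (by rwa [Nat.dvd_add_right (hpq.mul_left a)])
    push_cast at h2
    linear_combination (v l - a * q * v l ^ 2) * h2 -
      v (a * q + l) * (1 - a * q * v l) * h1 + v (a * q + l) * a ^ 2 * v l ^ 2 * hq

open PowerSeries in
theorem mk_eq_of_isPrimeToInv {A : Type*} [CommRing A] {p : ℕ} {v : ℕ → A}
    (h : IsPrimeToInv p v) {q : ℕ} (hq0 : q ≠ 0) (hpq : p ∣ q) (hq : (q : A) ^ 2 = 0) :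
    mk v = (trunc q (mk v) : A⟦X⟧) * expand q hq0 (mk 1) -
      C (q : A) * ((trunc q (mk fun l => v l ^ 2) : A⟦X⟧) *
        expand q hq0 (mk fun a => (a : A))) := by
  ext n
  rw [map_sub, coeff_C_mul, coeff_trunc_mul_expand, coeff_trunc_mul_expand]
  simp only [coeff_mk, Pi.one_apply, mul_one]
  conv_lhs => rw [← Nat.div_add_mod' n q, h.apply_mul_add hpq hq]
  ring

open PowerSeries in
theorem mk_natCast_eq {A : Type*} [CommRing A] :
    (mk fun a => (a : A)) = X * (mk 1 : A⟦X⟧) ^ 2 := by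
  rw [show (2 : ℕ) = 1 + 1 from rfl, mk_one_pow_eq_mk_choose_add]
  ext n
  cases n with
  | zero => simp
  | succ n => simp [coeff_succ_X_mul, add_comm]

-- Only the terms of degree at most one in `q` survive in the seventh power. With `Y = X ^ q`, their
-- denominators give `1 / (1 - Y) ^ 7` and `Y / (1 - Y) ^ 8`, hence the two binomial series.
open PowerSeries in
theorem mk_pow_seven_of_isPrimeToInv {A : Type*} [CommRing A] {p : ℕ} {v : ℕ → A}
    (h : IsPrimeToInv p v) {q : ℕ} (hq0 : q ≠ 0) (hpq : p ∣ q) (hq : (q : A) ^ 2 = 0) :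
    mk v ^ 7 = ((trunc q (mk v) ^ 7 : Polynomial A) : A⟦X⟧) *
        expand q hq0 (mk fun n => (Nat.choose (6 + n) 6 : A)) -
      C (7 * q : A) * (((trunc q (mk v) ^ 6 * trunc q (mk fun l => v l ^ 2) : Polynomial A) :
        A⟦X⟧) * expand q hq0 (mk fun n => (Nat.choose (6 + n) 7 : A))) := by
  have hc : (mk fun n => (Nat.choose (6 + n) 7 : A)) = (mk 1 : A⟦X⟧) ^ 6 * mk fun a => (a : A) := by
    rw [mk_natCast_eq, mul_left_comm, ← pow_add, show 6 + 2 = 7 + 1 from rfl,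
      mk_one_pow_eq_mk_choose_add]
    ext n
    cases n with
    | zero => simp
    | succ n => simp [coeff_succ_X_mul, show 7 + n = 6 + (n + 1) by omega]
  rw [hc, ← mk_one_pow_eq_mk_choose_add, mk_eq_of_isPrimeToInv h hq0 hpq hq]
  simp only [map_mul, map_pow, Polynomial.coe_pow, Polynomial.coe_mul]
  have hC : (C (q : A) : A⟦X⟧) ^ 2 = 0 := by rw [← map_pow, hq, map_zero]
  rw [map_ofNat (C : A →+* A⟦X⟧) 7]
  -- The preceding rewrite also replaced `mk v` inside the truncations; this restores them.
  have htr : (trunc q (mk v) : A⟦X⟧) = (trunc q ((trunc q (mk v) : A⟦X⟧) * expand q hq0 (mk 1) -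
      C (q : A) * ((trunc q (mk fun l => v l ^ 2) : A⟦X⟧) *
        expand q hq0 (mk fun a => (a : A)))) : A⟦X⟧) := by
    rw [← mk_eq_of_isPrimeToInv h hq0 hpq hq]
  rw [← htr]
  generalize (trunc q (mk v) : A⟦X⟧) = g at *
  generalize (trunc q (mk fun l => v l ^ 2) : A⟦X⟧) = u at *
  generalize expand q hq0 (mk 1 : A⟦X⟧) = P at *
  generalize expand q hq0 (mk fun a => (a : A)) = P' at *
  generalize (C (q : A) : A⟦X⟧) = c at *
  obtain ⟨k, hk⟩ := Polynomial.powAddExpansion (g * P) (-(c * (u * P'))) 7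
  rw [sub_eq_add_neg, hk]
  push_cast
  linear_combination k * (u * P') ^ 2 * hC

open PowerSeries in
theorem coeff_mul_mul_expand {A : Type*} [CommRing A] {q : ℕ} (hq : q ≠ 0) (G : Polynomial A)
    (hdeg : G.natDegree < 7 * q) (h0 : G.coeff 0 = 0) (w : A⟦X⟧) (M : ℕ) :
    coeff (M * q) ((G : A⟦X⟧) * expand q hq w) =
      ∑ k ∈ Finset.Icc 1 6, if k ≤ M then G.coeff (k * q) * coeff (M - k) w else 0 := by
  rw [coeff_mul_expand, Nat.mul_div_cancel _ (Nat.pos_of_ne_zero hq), ← Finset.sum_filter,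
    ← Finset.sum_range_reflect]
  symm
  have hterm : ∀ k ∈ Finset.range (M + 1),
      coeff (M * q - (M + 1 - 1 - k) * q) (G : A⟦X⟧) * coeff (M + 1 - 1 - k) w =
        G.coeff (k * q) * coeff (M - k) w := by
    intro k hk
    rw [Finset.mem_range] at hk
    rw [← Nat.sub_mul, show M - (M + 1 - 1 - k) = k by omega, Nat.add_sub_cancel,
      Polynomial.coeff_coe]
  rw [Finset.sum_congr rfl hterm]
  refine Finset.sum_subset ?_ ?_
  · intro k hk
    rw [Finset.mem_filter] at hk
    rw [Finset.mem_range]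
    omega
  · intro k hk hk'
    rw [Finset.mem_range] at hk
    rw [Finset.mem_filter, Finset.mem_Icc] at hk'
    rcases Nat.eq_zero_or_pos k with rfl | hpos
    · rw [zero_mul, h0, zero_mul]
    · rw [Polynomial.coeff_eq_zero_of_natDegree_lt, zero_mul]
      have : 7 ≤ k := by omega
      exact hdeg.trans_le (Nat.mul_le_mul_right q this)

theorem natDegree_trunc_le {A : Type*} [CommRing A] (q : ℕ) (f : PowerSeries A) :
    (PowerSeries.trunc q f).natDegree ≤ q - 1 := by
  rw [Polynomial.natDegree_le_iff_coeff_eq_zero]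
  intro N hN
  rw [PowerSeries.coeff_trunc, if_neg (by omega)]

theorem coeff_zero_trunc_mk {A : Type*} [CommRing A] (q : ℕ) {v : ℕ → A} (h : v 0 = 0) :
    (PowerSeries.trunc q (PowerSeries.mk v)).coeff 0 = 0 := by
  rw [PowerSeries.coeff_trunc, PowerSeries.coeff_mk, h, ite_self]

theorem coeff_mk_pow_seven_mul {A : Type*} [CommRing A] {p : ℕ} {v : ℕ → A}
    (h : IsPrimeToInv p v) {q : ℕ} (hq0 : q ≠ 0) (hpq : p ∣ q) (hq : (q : A) ^ 2 = 0) (M : ℕ)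
    (hM : ∀ k ∈ Finset.Icc 1 6, k ≤ M → (q : A) * (Nat.choose (6 + (M - k)) 7 : A) = 0) :
    PowerSeries.coeff (M * q) (PowerSeries.mk v ^ 7) =
      ∑ k ∈ Finset.Icc 1 6, blockCoeff v q k * (Nat.choose (M + 6 - k) 6 : A) := by
  have hv0 := h.zero_of_dvd 0 (dvd_zero p)
  have hg0 := coeff_zero_trunc_mk q hv0
  have hdeg := natDegree_trunc_le q (PowerSeries.mk v)
  have hdeg' := natDegree_trunc_le q (PowerSeries.mk fun l => v l ^ 2)
  rw [mk_pow_seven_of_isPrimeToInv h hq0 hpq hq, map_sub, PowerSeries.coeff_C_mul,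
    coeff_mul_mul_expand hq0, coeff_mul_mul_expand hq0]
  · have h2 : (7 * q : A) * (∑ k ∈ Finset.Icc 1 6, if k ≤ M then
        (PowerSeries.trunc q (PowerSeries.mk v) ^ 6 *
          PowerSeries.trunc q (PowerSeries.mk fun l => v l ^ 2)).coeff (k * q) *
          PowerSeries.coeff (M - k) (PowerSeries.mk fun n => (Nat.choose (6 + n) 7 : A))
        else 0) = 0 := by
      rw [Finset.mul_sum]
      refine Finset.sum_eq_zero fun k hk => ?_
      split_ifs with hkM
      · rw [PowerSeries.coeff_mk]
        linear_combination 7 * (PowerSeries.trunc q (PowerSeries.mk v) ^ 6 *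
          PowerSeries.trunc q (PowerSeries.mk fun l => v l ^ 2)).coeff (k * q) * hM k hk hkM
      · rw [mul_zero]
    rw [h2, sub_zero]
    refine Finset.sum_congr rfl fun k hk => ?_
    rw [Finset.mem_Icc] at hk
    split_ifs with hkM
    · rw [PowerSeries.coeff_mk, blockCoeff, show 6 + (M - k) = M + 6 - k by omega]
    · rw [Nat.choose_eq_zero_of_lt (by omega), Nat.cast_zero, mul_zero]
  · refine (Polynomial.natDegree_mul_le.trans (add_le_add Polynomial.natDegree_pow_le hdeg')).trans_lt
      ?_
    omega
  · rw [Polynomial.coeff_zero_eq_eval_zero, Polynomial.eval_mul, Polynomial.eval_pow,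
      ← Polynomial.coeff_zero_eq_eval_zero, hg0]
    ring
  · refine Polynomial.natDegree_pow_le.trans_lt ?_
    omega
  · rw [Polynomial.coeff_zero_eq_eval_zero, Polynomial.eval_pow,
      ← Polynomial.coeff_zero_eq_eval_zero, hg0]
    ring

theorem coeff_mk_pow_seven_mul_of_eq_zero {A : Type*} [CommRing A] {p : ℕ} {v : ℕ → A}
    (h : IsPrimeToInv p v) {q : ℕ} (hq0 : q ≠ 0) (hpq : p ∣ q) (hq : (q : A) = 0) (M : ℕ) :
    PowerSeries.coeff (M * q) (PowerSeries.mk v ^ 7) =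
      ∑ k ∈ Finset.Icc 1 6, blockCoeff v q k * (Nat.choose (M + 6 - k) 6 : A) :=
  coeff_mk_pow_seven_mul h hq0 hpq (by rw [hq]; ring) M fun _ _ _ => by rw [hq, zero_mul]

/-- Lucas: the last base-`p` digit of the upper entry is `6 - k < 7`. -/
theorem prime_dvd_choose_seven {p : ℕ} (hp : p.Prime) (hp7 : 7 < p) (m k : ℕ) (hk1 : 1 ≤ k)
    (hk : k ≤ 6) (hkm : k ≤ m * p) : p ∣ Nat.choose (6 + (m * p - k)) 7 := by
  have := Fact.mk hp
  have h := Choose.choose_modEq_choose_mod_mul_choose_div_nat (p := p)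
    (n := 6 + (m * p - k)) (k := 7)
  rw [show 6 + (m * p - k) = (6 - k) + m * p by omega, Nat.add_mul_mod_self_right,
    Nat.mod_eq_of_lt (by omega : 6 - k < p), Nat.mod_eq_of_lt hp7,
    Nat.choose_eq_zero_of_lt (by omega : 6 - k < 7), zero_mul] at h
  rw [show 6 + (m * p - k) = (6 - k) + m * p by omega]
  exact (Nat.modEq_zero_iff_dvd).1 h

theorem coeff_mk_pow_seven_mul_prime {A : Type*} [CommRing A] {p : ℕ} (hp : p.Prime)
    (hp7 : 7 < p) {v : ℕ → A} (h : IsPrimeToInv p v) {q : ℕ} (hq0 : q ≠ 0) (hpq : p ∣ q)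
    (hq : (p : A) * q = 0) (m : ℕ) :
    PowerSeries.coeff (m * p * q) (PowerSeries.mk v ^ 7) =
      ∑ k ∈ Finset.Icc 1 6, blockCoeff v q k * (Nat.choose (m * p + 6 - k) 6 : A) := by
  refine coeff_mk_pow_seven_mul h hq0 hpq ?_ _ fun k hk hkM => ?_
  · obtain ⟨c, hc⟩ := hpq
    calc (q : A) ^ 2 = (p : A) * q * c := by
          conv_lhs => rw [sq]; arg 1; rw [hc]
          push_cast; ring
      _ = 0 := by rw [hq, zero_mul]
  · rw [Finset.mem_Icc] at hk
    obtain ⟨c, hc⟩ := prime_dvd_choose_seven hp hp7 m k hk.1 hk.2 hkM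
    rw [hc]
    push_cast
    linear_combination (c : A) * hq

/-- The linear coefficient in `X` of `720 * choose (X + 6 - k) 6`. -/
def chooseLinCoeff : ℕ → ℤ
  | 1 => 120
  | 2 => -24
  | 3 => 12
  | 4 => -12
  | 5 => 24
  | 6 => -120
  | _ => 0

theorem cast_choose_six {A : Type*} [CommRing A] (n : ℕ) :
    720 * (Nat.choose n 6 : A) =
      (n : A) * ((n : A) - 1) * ((n : A) - 2) * ((n : A) - 3) * ((n : A) - 4) * ((n : A) - 5) := by
  have h : ((720 * n.choose 6 : ℕ) : A) = (n.descFactorial 6 : A) := by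
    rw [Nat.descFactorial_eq_factorial_mul_choose, show Nat.factorial 6 = 720 by decide]
  push_cast at h
  rw [h, ← descPochhammer_eval_eq_descFactorial]
  simp [descPochhammer_succ_right]

theorem sq_dvd_choose_six_sub (X k : ℕ) (hk1 : 1 ≤ k) (hk : k ≤ 6) :
    (X : ℤ) ^ 2 ∣ 720 * (Nat.choose (X + 6 - k) 6 : ℤ) - chooseLinCoeff k * X := by
  rw [cast_choose_six, Nat.cast_sub (by omega)]
  push_cast
  interval_cases k
  · exact ⟨274 * (X : ℤ) ^ 0 + 225 * (X : ℤ) ^ 1 + 85 * (X : ℤ) ^ 2 + 15 * (X : ℤ) ^ 3 + 1 * (X : ℤ) ^ 4, by rw [chooseLinCoeff]; push_cast; ring⟩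
  · exact ⟨(-26) * (X : ℤ) ^ 0 + 15 * (X : ℤ) ^ 1 + 25 * (X : ℤ) ^ 2 + 9 * (X : ℤ) ^ 3 + 1 * (X : ℤ) ^ 4, by rw [chooseLinCoeff]; push_cast; ring⟩
  · exact ⟨4 * (X : ℤ) ^ 0 + (-15) * (X : ℤ) ^ 1 + (-5) * (X : ℤ) ^ 2 + 3 * (X : ℤ) ^ 3 + 1 * (X : ℤ) ^ 4, by rw [chooseLinCoeff]; push_cast; ring⟩
  · exact ⟨4 * (X : ℤ) ^ 0 + 15 * (X : ℤ) ^ 1 + (-5) * (X : ℤ) ^ 2 + (-3) * (X : ℤ) ^ 3 + 1 * (X : ℤ) ^ 4, by rw [chooseLinCoeff]; push_cast; ring⟩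
  · exact ⟨(-26) * (X : ℤ) ^ 0 + (-15) * (X : ℤ) ^ 1 + 25 * (X : ℤ) ^ 2 + (-9) * (X : ℤ) ^ 3 + 1 * (X : ℤ) ^ 4, by rw [chooseLinCoeff]; push_cast; ring⟩
  · exact ⟨274 * (X : ℤ) ^ 0 + (-225) * (X : ℤ) ^ 1 + 85 * (X : ℤ) ^ 2 + (-15) * (X : ℤ) ^ 3 + 1 * (X : ℤ) ^ 4, by rw [chooseLinCoeff]; push_cast; ring⟩

/-! ### Symmetries of the truncated logarithm modulo `p` -/

open Polynomial in
theorem coeff_one_sub_X_pow {A : Type*} [CommRing A] (n k : ℕ) :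
    (((1 : A[X]) - X) ^ n).coeff k = (-1) ^ k * (n.choose k : A) := by
  have h : ((1 : A[X]) - X) ^ n = ((1 + X) ^ n).comp (C (-1) * X) := by
    simp [sub_eq_add_neg]
  rw [h, comp_C_mul_X_coeff, coeff_one_add_X_pow, mul_comm]

theorem sum_range_mul_eq {M : Type*} [AddCommMonoid M] (F : ℕ → M) (a p : ℕ) :
    ∑ n ∈ Finset.range (a * p), F n =
      ∑ t ∈ Finset.range a, ∑ s ∈ Finset.range p, F (t * p + s) := by
  induction a with
  | zero => simp
  | succ a ih => rw [add_mul, one_mul, Finset.sum_range_add, ih, Finset.sum_range_succ]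

/-- The truncation at degree `p` of the power series with coefficients `v`: for the reciprocal
function `v` modulo `p`, the first finite polylogarithm. -/
noncomputable def finLog {A : Type*} [CommRing A] (p : ℕ) (v : ℕ → A) : Polynomial A :=
  PowerSeries.trunc p (PowerSeries.mk v)

theorem coeff_finLog {A : Type*} [CommRing A] (p : ℕ) (v : ℕ → A) (n : ℕ) :
    (finLog p v).coeff n = if n < p then v n else 0 := by
  rw [finLog, PowerSeries.coeff_trunc, PowerSeries.coeff_mk]

theorem natDegree_finLog_le {A : Type*} [CommRing A] (p : ℕ) (v : ℕ → A) :
    (finLog p v).natDegree ≤ p - 1 := natDegree_trunc_le _ _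

theorem natDegree_finLog_pow_seven_lt {A : Type*} [CommRing A] {p : ℕ} (hp : 0 < p) (v : ℕ → A) :
    (finLog p v ^ 7).natDegree < 7 * p := by
  have := natDegree_finLog_le p v
  refine Polynomial.natDegree_pow_le.trans_lt ?_
  omega

theorem IsPrimeToInv.apply_sub {p : ℕ} [hp : Fact p.Prime] {v : ℕ → ZMod p}
    (h : IsPrimeToInv p v) {l : ℕ} (hl : l ≤ p) : v (p - l) = - v l := by
  by_cases hd : p ∣ l
  · rw [h.zero_of_dvd l hd, h.zero_of_dvd _ (Nat.dvd_sub (dvd_refl p) hd), neg_zero]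
  · have h1 := h.mul_eq_one l hd
    have h2 := h.mul_eq_one (p - l) fun h3 => hd (by
      have := Nat.dvd_sub (dvd_refl p) h3
      rwa [Nat.sub_sub_self hl] at this)
    rw [Nat.cast_sub hl, ZMod.natCast_self] at h2
    linear_combination - v (p - l) * h1 - v l * h2

open Polynomial in
theorem reflect_finLog {p : ℕ} [hp : Fact p.Prime] {v : ℕ → ZMod p} (h : IsPrimeToInv p v) :
    reflect p (finLog p v) = - finLog p v := by
  ext n
  rw [coeff_reflect, coeff_neg, coeff_finLog, coeff_finLog]
  have hp0 := hp.out.pos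
  have h0 := h.zero_of_dvd 0 (dvd_zero p)
  rcases lt_trichotomy n p with hn | rfl | hn
  · rw [revAt_le hn.le, if_pos hn]
    split_ifs with h1
    · exact h.apply_sub hn.le
    · have : n = 0 := by omega
      rw [this, h0, neg_zero]
  · rw [revAt_le le_rfl, Nat.sub_self, if_pos hp0, if_neg (lt_irrefl _), h0, neg_zero]
  · rw [revAt_eq_self_of_lt hn, if_neg (by omega), neg_zero]

open Polynomial in
theorem reflect_pow {A : Type*} [CommRing A] {g : A[X]} {p : ℕ} (hg : g.natDegree ≤ p) (n : ℕ) :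
    reflect (n * p) (g ^ n) = reflect p g ^ n := by
  induction n with
  | zero => simp
  | succ n ih =>
    rw [add_mul, one_mul, pow_succ, reflect_mul _ _ (natDegree_pow_le_of_le n hg) hg, ih, pow_succ]

theorem blockCoeff_eq {A : Type*} [CommRing A] (p : ℕ) (v : ℕ → A) (k : ℕ) :
    blockCoeff v p k = (finLog p v ^ 7).coeff (k * p) := rfl

open Polynomial in
theorem blockCoeff_seven_sub {p : ℕ} [hp : Fact p.Prime] {v : ℕ → ZMod p}
    (h : IsPrimeToInv p v) {k : ℕ} (hk : k ≤ 7) :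
    blockCoeff v p (7 - k) = - blockCoeff v p k := by
  have h1 := reflect_pow (n := 7) ((natDegree_finLog_le p v).trans (Nat.sub_le _ _))
  rw [reflect_finLog h] at h1
  have h2 := congrArg (fun f => f.coeff (k * p)) h1
  simp only [coeff_reflect, revAt_le (Nat.mul_le_mul_right p hk)] at h2
  rw [blockCoeff_eq, Nat.sub_mul, h2, Odd.neg_pow (by decide), coeff_neg, blockCoeff_eq]

open Polynomial in
theorem derivative_finLog {p : ℕ} [hp : Fact p.Prime] {v : ℕ → ZMod p} (h : IsPrimeToInv p v) :
    derivative (finLog p v) = ∑ i ∈ Finset.range (p - 1), X ^ i := by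
  ext n
  rw [coeff_derivative, coeff_finLog, finsetSum_coeff]
  simp only [coeff_X_pow, Finset.sum_ite_eq, Finset.mem_range]
  by_cases hn : n + 1 < p
  · rw [if_pos hn, if_pos (by omega)]
    have := h.mul_eq_one (n + 1) (Nat.not_dvd_of_pos_of_lt (by omega) hn)
    push_cast at this
    rw [mul_comm, this]
  · rw [if_neg hn, if_neg (by omega), zero_mul]

-- The derivative of `finLog`, times `X * (1 - X)`, is `X - X ^ p`, which changes sign under `X ↦ 1
-- - X` by Frobenius. So the difference of the two sides has zero derivative and degree below `p`,
-- hence is constant; the substitution negates it, so it is zero as `p` is odd.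
open Polynomial in
theorem finLog_comp_one_sub_X {p : ℕ} [hp : Fact p.Prime] (hp2 : 2 < p) {v : ℕ → ZMod p}
    (h : IsPrimeToInv p v) : (finLog p v).comp (1 - X) = finLog p v := by
  have hp1 : p - 1 + 1 = p := Nat.sub_add_cancel hp.out.one_le
  have hgeom (y : (ZMod p)[X]) : (∑ i ∈ Finset.range (p - 1), y ^ i) * (y * (1 - y)) = y - y ^ p := by
    have := geom_sum_mul_neg y (p - 1)
    calc _ = ((∑ i ∈ Finset.range (p - 1), y ^ i) * (1 - y)) * y := by ring
      _ = y - y ^ (p - 1 + 1) := by rw [this, pow_succ]; ring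
      _ = _ := by rw [hp1]
  have hd : (derivative (finLog p v)).comp (1 - X) = - derivative (finLog p v) := by
    rw [derivative_finLog h]
    have hne : (X : (ZMod p)[X]) * (1 - X) ≠ 0 := by
      refine mul_ne_zero X_ne_zero fun h0 => ?_
      have := congrArg (eval 0) h0
      simp at this
    refine mul_right_cancel₀ hne ?_
    have h1 := hgeom X
    have h2 := hgeom (1 - X)
    rw [sub_pow_char, one_pow] at h2
    simp only [Polynomial.sum_comp, pow_comp, X_comp]
    linear_combination h2 + h1
  set D := (finLog p v).comp (1 - X) - finLog p v with hD
  have hD0 : derivative D = 0 := by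
    rw [hD, derivative_sub, derivative_comp, hd]
    simp
  have hdeg : D.natDegree ≤ p - 1 := by
    refine (natDegree_sub_le _ _).trans (max_le ?_ (natDegree_finLog_le p v))
    refine natDegree_comp_le.trans ?_
    have h1 : ((1 : (ZMod p)[X]) - X).natDegree ≤ 1 := by
      refine (natDegree_sub_le _ _).trans ?_
      simp
    calc _ ≤ (p - 1) * 1 := Nat.mul_le_mul (natDegree_finLog_le p v) h1
      _ = _ := mul_one _
  have hDC : D = C (D.coeff 0) := by
    ext n
    rw [coeff_C]
    split_ifs with hn
    · rw [hn]
    · rcases lt_or_ge n p with hnp | hnp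
      · obtain ⟨m, rfl⟩ := Nat.exists_eq_succ_of_ne_zero hn
        have h3 := congrArg (fun f => f.coeff m) hD0
        simp only [coeff_derivative, coeff_zero] at h3
        rcases mul_eq_zero.1 h3 with h4 | h4
        · exact h4
        · exfalso
          have h5 : ((m + 1 : ℕ) : ZMod p) = 0 := by exact_mod_cast h4
          rw [ZMod.natCast_eq_zero_iff] at h5
          exact Nat.not_dvd_of_pos_of_lt (Nat.succ_pos m) hnp h5
      · exact coeff_eq_zero_of_natDegree_lt (by omega)
  have hneg : D.comp (1 - X) = - D := by
    rw [hD, sub_comp, comp_assoc]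
    simp
  rw [hDC] at hneg
  have h2 : (2 : ZMod p) ≠ 0 := by
    intro h2
    have : ((2 : ℕ) : ZMod p) = 0 := by exact_mod_cast h2
    rw [ZMod.natCast_eq_zero_iff] at this
    exact Nat.not_dvd_of_pos_of_lt two_pos hp2 this
  have hc : D.coeff 0 = 0 := by
    have h3 := congrArg (fun f => f.coeff 0) hneg
    simp only [C_comp, coeff_neg, coeff_C_zero] at h3
    have h4 : 2 * D.coeff 0 = 0 := by linear_combination h3
    exact (mul_eq_zero.1 h4).resolve_left h2
  rw [hc, C_0] at hDC
  exact sub_eq_zero.1 hDC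

theorem natCast_ne_zero_of_lt {p : ℕ} [hp : Fact p.Prime] {n : ℕ} (h0 : 0 < n) (hn : n < p) :
    (n : ZMod p) ≠ 0 := fun h => by
  rw [ZMod.natCast_eq_zero_iff] at h
  exact Nat.not_dvd_of_pos_of_lt h0 hn h

-- The derivative of `L ^ 8` has no term in degree `t * p + p - 1`. As `L' = 1 + ⋯ + X ^ (p - 2)`,
-- this coefficient is `8` times the sum over the block without its first entry, so only that entry
-- remains.
open Polynomial in
theorem sum_block_finLog_pow {p : ℕ} [hp : Fact p.Prime] (hp2 : 2 < p) {v : ℕ → ZMod p}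
    (h : IsPrimeToInv p v) (t : ℕ) :
    ∑ s ∈ Finset.range p, (finLog p v ^ 7).coeff (t * p + s) = blockCoeff v p t := by
  obtain ⟨r, rfl⟩ : ∃ r, p = r + 1 := ⟨p - 1, (Nat.sub_add_cancel hp.out.one_le).symm⟩
  rw [Finset.sum_range_succ', add_zero, blockCoeff_eq, add_eq_right]
  have h1 := congrArg (fun f => f.coeff (t * (r + 1) + r)) (derivative_pow_succ (finLog (r + 1) v) 7)
  simp only [coeff_derivative] at h1
  have h2 : ((t * (r + 1) + r : ℕ) : ZMod (r + 1)) + 1 = 0 := by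
    rw [← Nat.cast_succ, ZMod.natCast_eq_zero_iff]
    exact ⟨t + 1, by rw [Nat.succ_eq_add_one]; ring⟩
  rw [h2, mul_zero, mul_assoc, coeff_C_mul, derivative_finLog h, Finset.mul_sum,
    finsetSum_coeff] at h1
  have h3 : ((7 : ℕ) : ZMod (r + 1)) + 1 ≠ 0 := by
    have h2' := natCast_ne_zero_of_lt (p := r + 1) two_pos hp2
    -- The factor `8 = 2 ^ 3` is invertible because `p` is odd.
    have : ((7 : ℕ) : ZMod (r + 1)) + 1 = ((2 : ℕ) : ZMod (r + 1)) ^ 3 := by norm_num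
    rw [this]
    exact pow_ne_zero 3 h2'
  have h4 := (mul_eq_zero.1 h1.symm).resolve_left h3
  rw [← h4, Nat.add_sub_cancel, ← Finset.sum_range_reflect]
  refine Finset.sum_congr rfl fun i hi => ?_
  rw [Finset.mem_range] at hi
  rw [coeff_mul_X_pow', if_pos (by omega)]
  congr 1
  omega

-- Expand the invariance of `L ^ 7` under `X ↦ 1 - X`. By Lucas, `choose (t * p + s) (k * p)`
-- depends only on `t` modulo `p`, so the coefficients enter only through their block sums.
open Polynomial in
theorem blockCoeff_eq_sum {p : ℕ} [hp : Fact p.Prime] (hp2 : 2 < p) {v : ℕ → ZMod p}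
    (h : IsPrimeToInv p v) (k : ℕ) :
    blockCoeff v p k =
      (-1) ^ k * ∑ t ∈ Finset.range 7, (t.choose k : ZMod p) * blockCoeff v p t := by
  have hcomp : (finLog p v ^ 7).comp (1 - X) = finLog p v ^ 7 := by
    rw [pow_comp, finLog_comp_one_sub_X hp2 h]
  have hsign : ((-1 : ZMod p)) ^ (k * p) = (-1) ^ k := by
    rw [mul_comm, pow_mul, ZMod.pow_card]
  conv_lhs => rw [blockCoeff_eq, ← hcomp,
    as_sum_range' _ _ (natDegree_finLog_pow_seven_lt hp.out.pos v)]
  simp only [Polynomial.sum_comp, monomial_comp, finsetSum_coeff, coeff_C_mul, coeff_one_sub_X_pow,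
    hsign]
  rw [sum_range_mul_eq, Finset.mul_sum]
  refine Finset.sum_congr rfl fun t _ => ?_
  rw [← sum_block_finLog_pow hp2 h t, Finset.mul_sum, Finset.mul_sum]
  refine Finset.sum_congr rfl fun s hs => ?_
  rw [Finset.mem_range] at hs
  have hL := Choose.choose_modEq_choose_mod_mul_choose_div_nat (p := p)
    (n := t * p + s) (k := k * p)
  rw [Nat.mul_mod_left, Nat.choose_zero_right, one_mul, Nat.mul_div_cancel _ hp.out.pos,
    add_comm (t * p) s, Nat.add_mul_div_right _ _ hp.out.pos, Nat.div_eq_of_lt hs, zero_add] at hL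
  have hL' := (ZMod.natCast_eq_natCast_iff _ _ _).2 hL
  rw [add_comm (t * p) s, hL']
  ring

/-- The ratio of `blockCoeff v p k` to the Bernoulli number of index `p - 7` modulo `p`. -/
def blockRatio : ℕ → ℤ
  | 1 => -720
  | 2 => 2160
  | 3 => -3600
  | 4 => 3600
  | 5 => -2160
  | 6 => 720
  | _ => 0

/-- Reflection leaves three unknowns; the relations from `X ↦ 1 - X` at `k = 1, 2` force the ratios
`1 : -3 : 5`. -/
theorem blockCoeff_eq_blockRatio_mul {p : ℕ} [hp : Fact p.Prime] (hp2 : 2 < p) {v : ℕ → ZMod p}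
    (h : IsPrimeToInv p v) {b : ZMod p} (h1 : blockCoeff v p 1 = -720 * b) {k : ℕ}
    (hk1 : 1 ≤ k) (hk : k ≤ 6) : blockCoeff v p k = blockRatio k * b := by
  have h6 := blockCoeff_seven_sub h (k := 1) (by norm_num)
  have h5 := blockCoeff_seven_sub h (k := 2) (by norm_num)
  have h4 := blockCoeff_seven_sub h (k := 3) (by norm_num)
  have e1 := blockCoeff_eq_sum hp2 h 1
  have e2 := blockCoeff_eq_sum hp2 h 2
  simp only [Nat.reduceSub] at h4 h5 h6
  simp only [Finset.sum_range_succ, Finset.sum_range_zero, Nat.choose, h4, h5, h6, h1] at e1 e2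
  push_cast at e1 e2
  have hB2 : blockCoeff v p 2 = 2160 * b := by linear_combination 3 * e1 + e2
  have hB3 : blockCoeff v p 3 = -3600 * b := by
    rw [hB2] at e1
    linear_combination -e1
  rw [h1] at h6
  rw [hB2] at h5
  rw [hB3] at h4
  interval_cases k <;> simp only [blockRatio] <;> push_cast
  · exact h1
  · exact hB2
  · exact hB3
  · rw [h4]; ring
  · rw [h5]; ring
  · rw [h6]; ring

/-! ### The first block coefficient as a Bernoulli number -/

theorem sum_zmod_eq_sum_range {p : ℕ} [hp : Fact p.Prime] {M : Type*} [AddCommMonoid M]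
    (F : ZMod p → M) : ∑ x, F x = ∑ t ∈ Finset.range p, F (t : ZMod p) := by
  refine Finset.sum_bij' (fun x _ => x.val) (fun t _ => (t : ZMod p)) ?_ ?_ ?_ ?_ ?_
  · intro x _; exact Finset.mem_range.2 (ZMod.val_lt x)
  · intro t _; exact Finset.mem_univ _
  · intro x _; exact ZMod.natCast_zmod_val x
  · intro t ht; exact ZMod.val_cast_of_lt (Finset.mem_range.1 ht)
  · intro x _; rw [ZMod.natCast_zmod_val]

theorem sum_zmod_pow {p : ℕ} [hp : Fact p.Prime] {e : ℕ} (he : 0 < e) (he2 : e < 2 * (p - 1)) :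
    ∑ x : ZMod p, x ^ e = if e = p - 1 then -1 else 0 := by
  have hp1 := hp.out.two_le
  have h1 := FiniteField.sum_pow_units (ZMod p) e
  rw [ZMod.card] at h1
  have h2 : ∑ x : ZMod p, x ^ e = ∑ x : (ZMod p)ˣ, (x ^ e : ZMod p) := by
    rw [← Finset.sum_subset (Finset.subset_univ (Finset.univ.image (Units.val : (ZMod p)ˣ → ZMod p))),
      Finset.sum_image (fun a _ b _ h => Units.ext h)]
    intro x _ hx
    have : x = 0 := by
      by_contra h0
      exact hx (Finset.mem_image.2 ⟨Units.mk0 x h0, Finset.mem_univ _, rfl⟩)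
    rw [this, zero_pow he.ne']
  rw [h2]
  refine h1.trans ?_
  congr 1
  rw [eq_iff_iff]
  constructor
  · rintro ⟨c, rfl⟩
    have : c < 2 := by
      by_contra hc
      have := Nat.mul_le_mul_left (p - 1) (not_lt.1 hc)
      omega
    have : c ≠ 0 := by rintro rfl; simp at he
    have : c = 1 := by omega
    rw [this, mul_one]
  · rintro rfl; exact dvd_rfl

-- Orthogonality of powers: the exponents `i + (p - 1 - n)` lie strictly between `0` and `2 * (p -
-- 1)`, and only `i = n` gives `p - 1`.
open Polynomial in
theorem coeff_eq_neg_sum_eval {p : ℕ} [hp : Fact p.Prime] (Q : (ZMod p)[X])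
    (hQ : Q.natDegree < p) {n : ℕ} (hn0 : 0 < n) (hn : n < p - 1) :
    Q.coeff n = - ∑ x : ZMod p, Q.eval x * x ^ (p - 1 - n) := by
  have h1 : ∀ x : ZMod p, Q.eval x * x ^ (p - 1 - n) =
      ∑ i ∈ Finset.range p, Q.coeff i * x ^ (i + (p - 1 - n)) := by
    intro x
    rw [eval_eq_sum_range' hQ, Finset.sum_mul]
    exact Finset.sum_congr rfl fun i _ => by rw [pow_add, mul_assoc]
  rw [Finset.sum_congr rfl fun x _ => h1 x, Finset.sum_comm, Finset.sum_eq_single n]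
  · rw [← Finset.mul_sum, sum_zmod_pow (by omega) (by omega), if_pos (by omega)]
    ring
  · intro i hi hin
    rw [Finset.mem_range] at hi
    rw [← Finset.mul_sum, sum_zmod_pow (by omega) (by omega), if_neg (by omega), mul_zero]
  · intro h
    rw [Finset.mem_range] at h
    omega

/-- The polynomial `choose (X + u - 1) u`, with the reciprocals in its coefficients taken
from `v`. -/
noncomputable def risingChoose {A : Type*} [CommRing A] (v : ℕ → A) (u : ℕ) : Polynomial A :=
  ∏ w ∈ Finset.range u, (Polynomial.C (v (w + 1)) * (Polynomial.X + Polynomial.C (w : A)))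

-- Truncated form of `exp (-T * log (1 - X)) = (1 - X) ^ (-T)`, comparing coefficients of `T ^ n`.
-- The recursion `(u + 1) * R_{u+1} = (T + u) * R_u` matches `(1 - X) * (L ^ (n + 1))' = (n + 1) * L
-- ^ n * (1 - X ^ (p - 1))` in low degree.
open Polynomial in
theorem coeff_finLog_pow {p : ℕ} [hp : Fact p.Prime] {v : ℕ → ZMod p} (h : IsPrimeToInv p v)
    {u : ℕ} (hu : u < p) (n : ℕ) :
    (finLog p v ^ n).coeff u = n.factorial * (risingChoose v u).coeff n := by
  induction u generalizing n with
  | zero =>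
    have h0 : (finLog p v).coeff 0 = 0 := by
      rw [coeff_finLog, if_pos hu, h.zero_of_dvd 0 (dvd_zero p)]
    rw [coeff_zero_eq_eval_zero, eval_pow, ← coeff_zero_eq_eval_zero, h0]
    rcases n with _ | n
    · simp [risingChoose]
    · simp [risingChoose, coeff_one]
  | succ u ih =>
    have ih := ih (by omega)
    have hv : ((u : ZMod p) + 1) * v (u + 1) = 1 := by
      have := h.mul_eq_one (u + 1) (Nat.not_dvd_of_pos_of_lt (by omega) hu)
      exact_mod_cast this
    have hne : (u : ZMod p) + 1 ≠ 0 := left_ne_zero_of_mul_eq_one hv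
    have hE : C ((u : ZMod p) + 1) * risingChoose v (u + 1) =
        risingChoose v u * X + C (u : ZMod p) * risingChoose v u := by
      have hC : C ((u : ZMod p) + 1) * C (v (u + 1)) = 1 := by rw [← C_mul, hv, C_1]
      rw [risingChoose, Finset.prod_range_succ, ← risingChoose]
      linear_combination risingChoose v u * (X + C (u : ZMod p)) * hC
    rcases n with _ | n
    · have h1 := congrArg (fun f => f.coeff 0) hE
      have h2 := ih 0
      simp only [coeff_add, mul_coeff_zero, coeff_C_zero, coeff_X_zero, mul_zero, zero_add] at h1
      simp only [pow_zero, Nat.factorial_zero, Nat.cast_one, one_mul, coeff_one] at h2 ⊢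
      rw [← h2] at h1
      rw [if_neg (Nat.succ_ne_zero u)]
      symm
      refine (mul_eq_zero.1 (h1.trans ?_)).resolve_left hne
      split_ifs with hu0
      · rw [hu0]; simp
      · simp
    · have h1 := congrArg (fun f => f.coeff (n + 1)) hE
      simp only [coeff_C_mul, coeff_add, coeff_mul_X] at h1
      have h2 : derivative (finLog p v ^ (n + 1)) * (1 - X) =
          C ((n : ZMod p) + 1) * (finLog p v ^ n - finLog p v ^ n * X ^ (p - 1)) := by
        have := geom_sum_mul_neg (X : (ZMod p)[X]) (p - 1)
        rw [derivative_pow_succ, derivative_finLog h]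
        linear_combination C ((n : ZMod p) + 1) * finLog p v ^ n * this
      have h3 := congrArg (fun f => f.coeff u) h2
      simp only [mul_sub, mul_one, coeff_sub, coeff_C_mul, coeff_mul_X_pow',
        if_neg (by omega : ¬ p - 1 ≤ u), mul_zero, sub_zero, coeff_derivative] at h3
      have h4 : (derivative (finLog p v ^ (n + 1)) * X).coeff u =
          u * (finLog p v ^ (n + 1)).coeff u := by
        rcases u with _ | u
        · simp
        · rw [coeff_mul_X, coeff_derivative]; push_cast; ring
      rw [h4, ih, ih] at h3
      refine mul_left_cancel₀ hne ?_
      rw [Nat.factorial_succ] at h3 ⊢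
      push_cast at h3 ⊢
      linear_combination h3 - ((n : ZMod p) + 1) * n.factorial * h1

theorem natDegree_risingChoose_le {A : Type*} [CommRing A] (v : ℕ → A) (u : ℕ) :
    (risingChoose v u).natDegree ≤ u := by
  refine (Polynomial.natDegree_prod_le _ _).trans ?_
  refine (Finset.sum_le_card_nsmul _ _ 1 fun w _ => ?_).trans (by simp)
  refine (Polynomial.natDegree_C_mul_le _ _).trans ?_
  exact Polynomial.natDegree_add_le_of_degree_le Polynomial.natDegree_X_le (by simp)

open Polynomial in
theorem eval_risingChoose {p : ℕ} [hp : Fact p.Prime] {v : ℕ → ZMod p} (h : IsPrimeToInv p v)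
    {u : ℕ} (hu : u < p) (t : ℕ) :
    (risingChoose v u).eval (-(t : ZMod p)) = (-1) ^ u * (t.choose u : ZMod p) := by
  induction u with
  | zero => simp [risingChoose]
  | succ u ih =>
    have hv : ((u : ZMod p) + 1) * v (u + 1) = 1 := by
      have := h.mul_eq_one (u + 1) (Nat.not_dvd_of_pos_of_lt (by omega) hu)
      exact_mod_cast this
    rw [risingChoose, Finset.prod_range_succ, ← risingChoose, eval_mul, ih (by omega)]
    simp only [eval_mul, eval_C, eval_add, eval_X]
    have h1 : (t.choose (u + 1) : ZMod p) * (u + 1) = t.choose u * (t - u) := by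
      rcases le_or_gt u t with hut | hut
      · have := Nat.choose_succ_right_eq t u
        rw [← Nat.cast_sub hut, ← Nat.cast_succ, ← Nat.cast_mul, ← Nat.cast_mul, ← this]
      · rw [Nat.choose_eq_zero_of_lt hut, Nat.choose_eq_zero_of_lt (by omega)]
        simp
    rw [pow_succ]
    linear_combination (-1) ^ u * v (u + 1) * h1 - (-1) ^ u * (t.choose (u + 1) : ZMod p) * hv

theorem alternating_sum_range_choose_of_lt {A : Type*} [CommRing A] {t p : ℕ} (ht0 : 0 < t)
    (ht : t < p) : ∑ u ∈ Finset.range p, (-1 : A) ^ u * (t.choose u : A) = 0 := by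
  have h := Int.alternating_sum_range_choose (n := t)
  rw [if_neg ht0.ne'] at h
  have h' := congrArg (Int.cast : ℤ → A) h
  push_cast at h'
  rw [← h']
  symm
  refine Finset.sum_subset (Finset.range_subset_range.2 ht) fun u _ hu => ?_
  rw [Finset.mem_range] at hu
  rw [Nat.choose_eq_zero_of_lt (by omega), Nat.cast_zero, mul_zero]

theorem sum_alternating_choose_mul_inv {p : ℕ} [hp : Fact p.Prime] {v : ℕ → ZMod p}
    (h : IsPrimeToInv p v) {t : ℕ} (ht : t < p) :
    ∑ u ∈ Finset.range p, v u * ((-1) ^ u * (t.choose u : ZMod p)) =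
      - ∑ k ∈ Finset.Ico 1 (t + 1), v k := by
  induction t with
  | zero =>
    rw [Finset.Ico_self, Finset.sum_empty, neg_zero]
    refine Finset.sum_eq_zero fun u _ => ?_
    rcases u with _ | u
    · rw [h.zero_of_dvd 0 (dvd_zero p), zero_mul]
    · simp
  | succ t ih =>
    have ih := ih (by omega)
    rw [Finset.sum_Ico_succ_top (by omega), neg_add, ← ih, ← sub_eq_iff_eq_add',
      ← Finset.sum_sub_distrib]
    have hterm : ∀ u ∈ Finset.range p, v u * ((-1) ^ u * ((t + 1).choose u : ZMod p)) -
        v u * ((-1) ^ u * (t.choose u : ZMod p)) =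
        -- Since `v 0 = 0`, the term `u = 0` of the full alternating sum must be removed; it
        -- supplies the new harmonic term.
        v (t + 1) * ((-1) ^ u * ((t + 1).choose u : ZMod p)) - if u = 0 then v (t + 1) else 0 := by
      intro u hu
      rw [Finset.mem_range] at hu
      rcases u with _ | u
      · rw [h.zero_of_dvd 0 (dvd_zero p)]; simp
      · rw [if_neg (Nat.succ_ne_zero u)]
        have h1 := h.mul_eq_one (u + 1) (Nat.not_dvd_of_pos_of_lt (by omega) hu)
        have h2 := h.mul_eq_one (t + 1) (Nat.not_dvd_of_pos_of_lt (by omega) ht)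
        have h3 : ((t + 1).choose (u + 1) : ZMod p) = t.choose u + t.choose (u + 1) := by
          exact_mod_cast congrArg (Nat.cast : ℕ → ZMod p) (Nat.choose_succ_succ t u)
        have h4 : ((t + 1 : ℕ) : ZMod p) * t.choose u =
            (t + 1).choose (u + 1) * ((u + 1 : ℕ) : ZMod p) := by
          exact_mod_cast congrArg (Nat.cast : ℕ → ZMod p) (Nat.add_one_mul_choose_eq t u)
        linear_combination (-1) ^ (u + 1) * v (u + 1) * h3 -
          (-1) ^ (u + 1) * v (u + 1) * t.choose u * h2 +
          (-1) ^ (u + 1) * v (u + 1) * v (t + 1) * h4 +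
          (-1) ^ (u + 1) * v (t + 1) * ((t + 1).choose (u + 1)) * h1
    rw [Finset.sum_congr rfl hterm, Finset.sum_sub_distrib, ← Finset.mul_sum,
      alternating_sum_range_choose_of_lt (by omega) ht, Finset.sum_ite_eq',
      if_pos (Finset.mem_range.2 hp.out.pos)]
    ring

theorem blockCoeff_one_eq_sum {p : ℕ} [hp : Fact p.Prime] {v : ℕ → ZMod p}
    (h : IsPrimeToInv p v) :
    blockCoeff v p 1 = -∑ u ∈ Finset.range p, v u * (finLog p v ^ 6).coeff u := by
  rw [blockCoeff_eq, one_mul, pow_succ, Polynomial.coeff_mul,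
    Finset.Nat.sum_antidiagonal_eq_sum_range_succ
      (fun i j => (finLog p v ^ 6).coeff i * (finLog p v).coeff j),
    Finset.sum_range_succ, Nat.sub_self, coeff_finLog, if_pos hp.out.pos,
    h.zero_of_dvd 0 (dvd_zero p), mul_zero, add_zero, ← Finset.sum_neg_distrib]
  refine Finset.sum_congr rfl fun u hu => ?_
  rw [Finset.mem_range] at hu
  rw [coeff_finLog]
  split_ifs with h1
  · rw [h.apply_sub hu.le]; ring
  · have : u = 0 := by omega
    rw [this, h.zero_of_dvd 0 (dvd_zero p)]; ring

-- The sum over `u` is `-720` times the `T ^ 6` coefficient of `Z = ∑ v u * choose (T + u - 1) u`.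
-- At `T = -t`, `Z` is minus a harmonic sum, and the coefficient is recovered from these values by
-- orthogonality.
open Polynomial in
theorem blockCoeff_one_eq_sum_harmonic {p : ℕ} [hp : Fact p.Prime] (hp7 : 7 < p)
    {v : ℕ → ZMod p} (h : IsPrimeToInv p v) :
    blockCoeff v p 1 =
      -720 * ∑ t ∈ Finset.range p, (∑ k ∈ Finset.Ico 1 (t + 1), v k) * (t : ZMod p) ^ (p - 7) := by
  set Z : (ZMod p)[X] := ∑ u ∈ Finset.range p, C (v u) * risingChoose v u with hZ
  have hZdeg : Z.natDegree < p := by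
    have : Z.natDegree ≤ p - 1 := by
      refine natDegree_sum_le_of_forall_le _ _ fun u hu => ?_
      rw [Finset.mem_range] at hu
      exact (natDegree_C_mul_le _ _).trans ((natDegree_risingChoose_le v u).trans (by omega))
    omega
  have h1 : blockCoeff v p 1 = -720 * Z.coeff 6 := by
    rw [blockCoeff_one_eq_sum h, hZ, finsetSum_coeff, Finset.mul_sum, ← Finset.sum_neg_distrib]
    refine Finset.sum_congr rfl fun u hu => ?_
    rw [coeff_finLog_pow h (Finset.mem_range.1 hu), coeff_C_mul]
    norm_num [Nat.factorial]
    ring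
  have hev : ∀ t ∈ Finset.range p, Z.eval (-(t : ZMod p)) = -∑ k ∈ Finset.Ico 1 (t + 1), v k := by
    intro t ht
    rw [← sum_alternating_choose_mul_inv h (Finset.mem_range.1 ht), hZ, eval_finsetSum]
    refine Finset.sum_congr rfl fun u hu => ?_
    rw [eval_mul, eval_C, eval_risingChoose h (Finset.mem_range.1 hu)]
  have heven : Even (p - 7) := by
    have := hp.out.odd_of_ne_two (by omega)
    exact Nat.Odd.sub_odd this (by decide)
  rw [h1, coeff_eq_neg_sum_eval Z hZdeg (by norm_num) (by omega), ← Equiv.sum_comp (Equiv.neg _),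
    sum_zmod_eq_sum_range, ← Finset.sum_neg_distrib]
  congr 1
  refine Finset.sum_congr rfl fun t ht => ?_
  rw [Equiv.neg_apply, hev t ht, show p - 1 - 6 = p - 7 by omega, heven.neg_pow]
  ring

theorem natCast_choose_sub_one_six {p : ℕ} [hp : Fact p.Prime] (hp7 : 7 < p) :
    ((p - 1).choose (p - 7) : ZMod p) = 1 := by
  have h1 : (p - 1).choose (p - 7) = (p - 1).choose 6 := by
    rw [← Nat.choose_symm (by omega : 6 ≤ p - 1)]; congr 1
  obtain ⟨r, rfl⟩ := Nat.exists_eq_add_of_le (show 7 ≤ p by omega)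
  have h2 : 720 * (7 + r - 1).choose 6 = (r + 6) * (r + 5) * (r + 4) * (r + 3) * (r + 2) * (r + 1) := by
    have := Nat.descFactorial_eq_factorial_mul_choose (7 + r - 1) 6
    rw [show (720 : ℕ) = Nat.factorial 6 by decide, ← this, show 7 + r - 1 = r + 6 by omega]
    simp only [Nat.descFactorial, Nat.sub_zero, show r + 6 - 5 = r + 1 by omega, show r + 6 - 4 = r + 2 by omega,
      show r + 6 - 3 = r + 3 by omega, show r + 6 - 2 = r + 4 by omega,
      show r + 6 - 1 = r + 5 by omega]
    ring
  have hr : (r : ZMod (7 + r)) = -7 := by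
    have := ZMod.natCast_self (7 + r)
    push_cast at this
    linear_combination this
  have h3 := congrArg (Nat.cast : ℕ → ZMod (7 + r)) h2
  push_cast at h3
  rw [hr] at h3
  have hne : ((720 : ℕ) : ZMod (7 + r)) ≠ 0 := by
    rw [Ne, ZMod.natCast_eq_zero_iff, show 720 = Nat.factorial 6 by decide, hp.out.dvd_factorial]
    omega
  rw [h1]
  refine mul_left_cancel₀ hne ?_
  push_cast
  linear_combination h3

theorem IsPrimeToInv.eq_pow {p : ℕ} [hp : Fact p.Prime] (hp2 : 2 < p) {v : ℕ → ZMod p}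
    (h : IsPrimeToInv p v) (k : ℕ) : v k = (k : ZMod p) ^ (p - 2) := by
  by_cases hk : p ∣ k
  · rw [h.zero_of_dvd k hk, (ZMod.natCast_eq_zero_iff _ _).2 hk, zero_pow (by omega)]
  · have h1 := h.mul_eq_one k hk
    have hne : (k : ZMod p) ≠ 0 := left_ne_zero_of_mul_eq_one h1
    have h2 := ZMod.pow_card_sub_one_eq_one hne
    rw [show p - 1 = p - 2 + 1 by omega, pow_succ'] at h2
    exact mul_left_cancel₀ hne (h1.trans h2.symm)

/-- By Fermat the harmonic sums are power sums of exponent `p - 2`. After Faulhaber's formula `hβ`,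
summing over `t` keeps only `i = p - 7`. -/
theorem blockCoeff_one_eq {p : ℕ} [hp : Fact p.Prime] (hp7 : 7 < p)
    {v : ℕ → ZMod p} (h : IsPrimeToInv p v) (β : ℕ → ZMod p)
    (hβ : ∀ t : ℕ, ((p - 1 : ℕ) : ZMod p) * ∑ k ∈ Finset.Ico 1 (t + 1), (k : ZMod p) ^ (p - 2) =
      ∑ i ∈ Finset.range (p - 1), β i * ((p - 1).choose i : ZMod p) * (t : ZMod p) ^ (p - 1 - i)) :
    blockCoeff v p 1 = -720 * β (p - 7) := by
  rw [blockCoeff_one_eq_sum_harmonic hp7 h]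
  congr 1
  have hm1 : ((p - 1 : ℕ) : ZMod p) = -1 := by
    rw [Nat.cast_sub hp.out.one_le, ZMod.natCast_self]; simp
  have hterm : ∀ t ∈ Finset.range p,
      (∑ k ∈ Finset.Ico 1 (t + 1), v k) * (t : ZMod p) ^ (p - 7) =
      ∑ i ∈ Finset.range (p - 1), -(β i * ((p - 1).choose i : ZMod p)) *
        (t : ZMod p) ^ (p - 1 - i + (p - 7)) := by
    intro t _
    have h1 : ∑ k ∈ Finset.Ico 1 (t + 1), v k = -∑ i ∈ Finset.range (p - 1),
        β i * ((p - 1).choose i : ZMod p) * (t : ZMod p) ^ (p - 1 - i) := by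
      rw [← hβ t, hm1, Finset.sum_congr rfl fun k _ => h.eq_pow (by omega) k]
      ring
    rw [h1, neg_mul, Finset.sum_mul, ← Finset.sum_neg_distrib]
    exact Finset.sum_congr rfl fun i _ => by rw [pow_add]; ring
  rw [Finset.sum_congr rfl hterm, Finset.sum_comm, Finset.sum_eq_single (p - 7)]
  · rw [← Finset.mul_sum, ← sum_zmod_eq_sum_range (fun x : ZMod p => x ^ (p - 1 - (p - 7) + (p - 7))),
      sum_zmod_pow (by omega) (by omega), if_pos (by omega), natCast_choose_sub_one_six hp7]
    ring
  · intro i hi hne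
    rw [Finset.mem_range] at hi
    rw [← Finset.mul_sum, ← sum_zmod_eq_sum_range (fun x : ZMod p => x ^ (p - 1 - i + (p - 7))),
      sum_zmod_pow (by omega) (by omega), if_neg (by omega), mul_zero]
  · intro hi
    rw [Finset.mem_range] at hi
    omega

/-! ### Lifting through powers of `p` -/

theorem pow_dvd_coeff_mk_pow_seven_sub {A : Type*} [CommRing A] {p : ℕ} (hp : p.Prime)
    {v : ℕ → A} (h : IsPrimeToInv p v) (n M : ℕ) :
    (p : A) ^ (n + 1) ∣ PowerSeries.coeff (M * p ^ (n + 1)) (PowerSeries.mk v ^ 7) -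
      ∑ k ∈ Finset.Icc 1 6, blockCoeff v (p ^ (n + 1)) k * (Nat.choose (M + 6 - k) 6 : A) := by
  rw [← Ideal.mem_span_singleton, ← Ideal.Quotient.eq_zero_iff_mem]
  set φ := Ideal.Quotient.mk (Ideal.span {(p : A) ^ (n + 1)})
  have hz : ((p ^ (n + 1) : ℕ) : A ⧸ Ideal.span {(p : A) ^ (n + 1)}) = 0 := by
    rw [← map_natCast φ, Ideal.Quotient.eq_zero_iff_mem, Nat.cast_pow]
    exact Ideal.mem_span_singleton_self _
  have h1 := coeff_mk_pow_seven_mul_of_eq_zero (h.map φ) (pow_ne_zero _ hp.ne_zero)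
    (dvd_pow_self p (Nat.succ_ne_zero n)) hz M
  simp only [blockCoeff_map] at h1
  rw [map_sub, map_sum, ← coeff_mk_pow_map, h1, sub_eq_zero]
  simp only [map_mul, map_natCast]

theorem pow_dvd_coeff_mk_pow_seven_mul_prime_sub {A : Type*} [CommRing A] {p : ℕ} (hp : p.Prime)
    (hp7 : 7 < p) {v : ℕ → A} (h : IsPrimeToInv p v) (n m : ℕ) :
    (p : A) ^ (n + 2) ∣ PowerSeries.coeff (m * p * p ^ (n + 1)) (PowerSeries.mk v ^ 7) -
      ∑ k ∈ Finset.Icc 1 6, blockCoeff v (p ^ (n + 1)) k * (Nat.choose (m * p + 6 - k) 6 : A) := by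
  rw [← Ideal.mem_span_singleton, ← Ideal.Quotient.eq_zero_iff_mem]
  set φ := Ideal.Quotient.mk (Ideal.span {(p : A) ^ (n + 2)})
  have hz : (p : A ⧸ Ideal.span {(p : A) ^ (n + 2)}) * ((p ^ (n + 1) : ℕ) : A ⧸ _) = 0 := by
    rw [← map_natCast φ, ← map_natCast φ, ← map_mul, Ideal.Quotient.eq_zero_iff_mem, Nat.cast_pow,
      ← pow_succ']
    exact Ideal.mem_span_singleton_self _
  have h1 := coeff_mk_pow_seven_mul_prime hp hp7 (h.map φ) (pow_ne_zero _ hp.ne_zero)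
    (dvd_pow_self p (Nat.succ_ne_zero n)) hz m
  simp only [blockCoeff_map] at h1
  rw [map_sub, map_sum, ← coeff_mk_pow_map, h1, sub_eq_zero]
  simp only [map_mul, map_natCast]

theorem IsPrimeToInv.isUnit {A : Type*} [CommRing A] {p : ℕ} {v : ℕ → A}
    (h : IsPrimeToInv p v) {l : ℕ} (hl : ¬ p ∣ l) : IsUnit (l : A) :=
  IsUnit.of_mul_eq_one _ (h.mul_eq_one l hl)

theorem not_dvd_seven_hundred_twenty {p : ℕ} (hp : p.Prime) (hp7 : 7 < p) : ¬ p ∣ 720 := by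
  rw [show 720 = Nat.factorial 6 by decide, hp.dvd_factorial]
  omega

/-- Up to the unit `720`, the weights are `chooseLinCoeff k * m * p` modulo `p ^ 2`; their factor
`p` gains one power of precision. -/
theorem pow_dvd_coeff_sub_of_blockCoeff {A : Type*} [CommRing A] {p : ℕ} (hp : p.Prime)
    (hp7 : 7 < p) {v : ℕ → A} (h : IsPrimeToInv p v) {n : ℕ} {D : A} {ρ : ℕ → A}
    (hρ : ∀ k ∈ Finset.Icc 1 6,
      (p : A) ^ (n + 1) ∣ blockCoeff v (p ^ (n + 1)) k - (p : A) ^ n * ρ k)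
    (hD : (p : A) ∣ ∑ k ∈ Finset.Icc 1 6, (chooseLinCoeff k : A) * ρ k - 720 * D) (m : ℕ) :
    (p : A) ^ (n + 2) ∣ PowerSeries.coeff (m * p * p ^ (n + 1)) (PowerSeries.mk v ^ 7) -
      (p : A) ^ (n + 1) * (m * D) := by
  have hu : IsUnit ((720 : ℕ) : A) := h.isUnit (not_dvd_seven_hundred_twenty hp hp7)
  have h1 := pow_dvd_coeff_mk_pow_seven_mul_prime_sub hp hp7 h n m
  have h2 : (p : A) ^ (n + 2) ∣ ∑ k ∈ Finset.Icc 1 6,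
      (720 * (blockCoeff v (p ^ (n + 1)) k * (Nat.choose (m * p + 6 - k) 6 : A)) -
        (p : A) ^ (n + 1) * m * ((chooseLinCoeff k : A) * ρ k)) := by
    refine Finset.dvd_sum fun k hk => ?_
    obtain ⟨x, hx⟩ := hρ k hk
    rw [Finset.mem_Icc] at hk
    obtain ⟨e, he⟩ := sq_dvd_choose_six_sub (m * p) k hk.1 hk.2
    have he' := congrArg (Int.cast : ℤ → A) he
    push_cast at he'
    refine ⟨(chooseLinCoeff k : A) * m * x + m ^ 2 * e * ρ k + p * m ^ 2 * e * x, ?_⟩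
    linear_combination (blockCoeff v (p ^ (n + 1)) k) * he' +
      (chooseLinCoeff k * (m * p) + (m * p : A) ^ 2 * e) * hx
  rw [Finset.sum_sub_distrib, ← Finset.mul_sum, ← Finset.mul_sum] at h2
  obtain ⟨a, ha⟩ := h1
  obtain ⟨b, hb⟩ := h2
  obtain ⟨c, hc⟩ := hD
  rw [← hu.dvd_mul_left]
  push_cast
  refine ⟨720 * a + b + m * c, ?_⟩
  linear_combination 720 * ha + hb + (p : A) ^ (n + 1) * m * hc

/-- The coefficients of `X * (1 - X) ^ 5`. -/
def signedChooseFive : ℕ → ℤ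
  | 1 => 1
  | 2 => -5
  | 3 => 10
  | 4 => -10
  | 5 => 5
  | 6 => -1
  | _ => 0

/-- The weights amount to division by `(1 - X) ^ 7`, so sums linear in `m` give `(1 - X) ^ 7 * (X /
(1 - X) ^ 2) = X * (1 - X) ^ 5`. -/
theorem pow_dvd_blockCoeff_sub {A : Type*} [CommRing A] {p : ℕ} (hp : p.Prime)
    {v : ℕ → A} (h : IsPrimeToInv p v) {n : ℕ} {D : A}
    (hT : ∀ m : ℕ, (p : A) ^ (n + 1) ∣
      PowerSeries.coeff (m * p ^ (n + 1)) (PowerSeries.mk v ^ 7) - (p : A) ^ n * (m * D)) :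
    ∀ k ∈ Finset.Icc 1 6,
      (p : A) ^ (n + 1) ∣ blockCoeff v (p ^ (n + 1)) k - (p : A) ^ n * (signedChooseFive k * D) := by
  have key (M : ℕ) : ∃ z : A, ∑ k ∈ Finset.Icc 1 6,
      blockCoeff v (p ^ (n + 1)) k * (Nat.choose (M + 6 - k) 6 : A) - (p : A) ^ n * (M * D) =
      (p : A) ^ (n + 1) * z := by
    have := dvd_sub (hT M) (pow_dvd_coeff_mk_pow_seven_sub hp h n M)
    rwa [sub_sub_sub_cancel_left] at this
  obtain ⟨z1, h1⟩ := key 1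
  obtain ⟨z2, h2⟩ := key 2
  obtain ⟨z3, h3⟩ := key 3
  obtain ⟨z4, h4⟩ := key 4
  obtain ⟨z5, h5⟩ := key 5
  obtain ⟨z6, h6⟩ := key 6
  have hI : Finset.Icc 1 6 = {1, 2, 3, 4, 5, 6} := by decide
  simp [hI, Nat.choose] at h1 h2 h3 h4 h5 h6
  intro k hk
  rw [Finset.mem_Icc] at hk
  obtain ⟨hk1, hk6⟩ := hk
  interval_cases k <;> simp only [signedChooseFive] <;> push_cast
  -- The multipliers `1, -7, 21, -35, …` are the coefficients of `(1 - X) ^ 7`.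
  · exact ⟨z1, by linear_combination h1⟩
  · exact ⟨z2 - 7 * z1, by linear_combination h2 - 7 * h1⟩
  · exact ⟨z3 - 7 * z2 + 21 * z1, by linear_combination h3 - 7 * h2 + 21 * h1⟩
  · exact ⟨z4 - 7 * z3 + 21 * z2 - 35 * z1, by
      linear_combination h4 - 7 * h3 + 21 * h2 - 35 * h1⟩
  · exact ⟨z5 - 7 * z4 + 21 * z3 - 35 * z2 + 35 * z1, by
      linear_combination h5 - 7 * h4 + 21 * h3 - 35 * h2 + 35 * h1⟩
  · exact ⟨z6 - 7 * z5 + 21 * z4 - 35 * z3 + 35 * z2 - 21 * z1, by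
      linear_combination h6 - 7 * h5 + 21 * h4 - 35 * h3 + 35 * h2 - 21 * h1⟩

/-- Pairing `chooseLinCoeff` with `blockRatio` gives `720 * (-504)`, which starts the induction;
pairing it with `signedChooseFive` gives `720`, so the constant persists. -/
theorem pow_dvd_coeff_mk_pow_seven {A : Type*} [CommRing A] {p : ℕ} (hp : p.Prime)
    (hp7 : 7 < p) {v : ℕ → A} (h : IsPrimeToInv p v) {b : A}
    (hb : ∀ k ∈ Finset.Icc 1 6, (p : A) ∣ blockCoeff v p k - blockRatio k * b) (n m : ℕ) :
    (p : A) ^ (n + 2) ∣ PowerSeries.coeff (m * p ^ (n + 2)) (PowerSeries.mk v ^ 7) -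
      (p : A) ^ (n + 1) * (m * (-504 * b)) := by
  have hI : Finset.Icc 1 6 = {1, 2, 3, 4, 5, 6} := by decide
  induction n generalizing m with
  | zero =>
    have := pow_dvd_coeff_sub_of_blockCoeff hp hp7 h (n := 0) (D := -504 * b)
      (ρ := fun k => blockRatio k * b)
      (fun k hk => by simpa using hb k hk) (by
        simp only [hI]
        norm_num [chooseLinCoeff, blockRatio]
        ring_nf
        simp) m
    rwa [show m * p * p ^ (0 + 1) = m * p ^ (0 + 2) by ring] at this
  | succ n ih =>
    have := pow_dvd_coeff_sub_of_blockCoeff hp hp7 h (n := n + 1) (D := -504 * b)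
      (ρ := fun k => signedChooseFive k * (-504 * b))
      (pow_dvd_blockCoeff_sub hp h ih) (by
        simp only [hI]
        norm_num [chooseLinCoeff, signedChooseFive]
        ring_nf
        simp) m
    rwa [show m * p * p ^ (n + 1 + 1) = m * p ^ (n + 1 + 2) by ring] at this

theorem sum_blockRatio_mul_choose (m : ℕ) :
    ∑ k ∈ Finset.Icc 1 6, blockRatio k * (Nat.choose (m + 6 - k) 6 : ℤ) =
      -(504 * (m : ℤ) + 210 * (m : ℤ) ^ 3 + 6 * (m : ℤ) ^ 5) := by
  refine mul_left_cancel₀ (show (720 : ℤ) ≠ 0 by norm_num) ?_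
  have hI : Finset.Icc 1 6 = {1, 2, 3, 4, 5, 6} := by decide
  have hterm : ∀ k ∈ Finset.Icc 1 6, 720 * (blockRatio k * (Nat.choose (m + 6 - k) 6 : ℤ)) =
      blockRatio k * (((m : ℤ) + 6 - k) * ((m : ℤ) + 6 - k - 1) * ((m : ℤ) + 6 - k - 2) *
        ((m : ℤ) + 6 - k - 3) * ((m : ℤ) + 6 - k - 4) * ((m : ℤ) + 6 - k - 5)) := by
    intro k hk
    rw [Finset.mem_Icc] at hk
    rw [mul_left_comm, cast_choose_six, Nat.cast_sub (by omega)]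
    push_cast
    ring
  rw [Finset.mul_sum, Finset.sum_congr rfl hterm, hI]
  simp [blockRatio]
  ring

theorem dvd_coeff_mk_pow_seven {A : Type*} [CommRing A] {p : ℕ} (hp : p.Prime)
    {v : ℕ → A} (h : IsPrimeToInv p v) {b : A}
    (hb : ∀ k ∈ Finset.Icc 1 6, (p : A) ∣ blockCoeff v p k - blockRatio k * b) (m : ℕ) :
    (p : A) ∣ PowerSeries.coeff (m * p) (PowerSeries.mk v ^ 7) -
      -(504 * (m : A) + 210 * (m : A) ^ 3 + 6 * (m : A) ^ 5) * b := by
  have h1 := pow_dvd_coeff_mk_pow_seven_sub hp h 0 m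
  simp only [zero_add, pow_one] at h1
  have h2 : (p : A) ∣ ∑ k ∈ Finset.Icc 1 6, (blockCoeff v p k - blockRatio k * b) *
      (Nat.choose (m + 6 - k) 6 : A) :=
    Finset.dvd_sum fun k hk => (hb k hk).mul_right _
  have h3 := congrArg (Int.cast : ℤ → A) (sum_blockRatio_mul_choose m)
  push_cast at h3
  rw [← h3, Finset.sum_mul]
  convert dvd_add h1 h2 using 1
  rw [sub_add, ← Finset.sum_sub_distrib]
  congr 1
  exact Finset.sum_congr rfl fun k _ => by ring

/-! ### Bernoulli numbers in `ℤ_[p]` and transfer to `ℚ` -/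

/-- The recursion for Bernoulli numbers divides only by `n + 1`, a `p`-adic unit in this range. -/
theorem norm_bernoulli'_le_one {p : ℕ} [hp : Fact p.Prime] (n : ℕ) (hn : n + 1 < p) :
    ‖((bernoulli' n : ℚ) : ℚ_[p])‖ ≤ 1 := by
  induction n using Nat.strong_induction_on with
  | _ n ih =>
    have h := sum_bernoulli' (n + 1)
    rw [Finset.sum_range_succ, Nat.choose_succ_self_right] at h
    have h1 : (((n + 1 : ℕ) : ℚ_[p])) * ((bernoulli' n : ℚ) : ℚ_[p]) =
        ((n + 1 : ℕ) : ℚ_[p]) -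
          ∑ k ∈ Finset.range n, ((n + 1).choose k : ℚ_[p]) * ((bernoulli' k : ℚ) : ℚ_[p]) := by
      rw [eq_sub_iff_add_eq, add_comm]
      exact_mod_cast congrArg (Rat.cast : ℚ → ℚ_[p]) h
    have hmem : (((n + 1 : ℕ) : ℚ_[p])) * ((bernoulli' n : ℚ) : ℚ_[p]) ∈ PadicInt.subring p := by
      rw [h1]
      refine sub_mem (natCast_mem _ _) (sum_mem fun k hk => mul_mem (natCast_mem _ _) ?_)
      rw [Finset.mem_range] at hk
      exact ih k hk (by omega)
    have h2 : ‖((n + 1 : ℕ) : ℚ_[p])‖ = 1 := by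
      rw [Padic.norm_natCast_eq_one_iff]
      exact Nat.coprime_of_lt_prime (by omega) hn hp.out
    have h3 : ‖(((n + 1 : ℕ) : ℚ_[p])) * ((bernoulli' n : ℚ) : ℚ_[p])‖ ≤ 1 := hmem
    rwa [norm_mul, h2, one_mul] at h3

theorem exists_padicInt_bernoulli' (p : ℕ) [hp : Fact p.Prime] :
    ∃ β : ℕ → ℤ_[p], ∀ i, i + 1 < p → (β i : ℚ_[p]) = ((bernoulli' i : ℚ) : ℚ_[p]) := by
  have h (i : ℕ) : ∃ x : ℤ_[p], i + 1 < p → (x : ℚ_[p]) = ((bernoulli' i : ℚ) : ℚ_[p]) := by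
    by_cases hi : i + 1 < p
    · exact ⟨⟨_, norm_bernoulli'_le_one i hi⟩, fun _ => rfl⟩
    · exact ⟨0, fun h => absurd h hi⟩
  choose β hβ using h
  exact ⟨β, hβ⟩

theorem sum_pow_eq_sum_bernoulli_padicInt {p : ℕ} [hp : Fact p.Prime] (hp2 : 2 < p)
    {β : ℕ → ℤ_[p]} (hβ : ∀ i, i + 1 < p → (β i : ℚ_[p]) = ((bernoulli' i : ℚ) : ℚ_[p])) (t : ℕ) :
    ((p - 1 : ℕ) : ℤ_[p]) * ∑ k ∈ Finset.Ico 1 (t + 1), (k : ℤ_[p]) ^ (p - 2) =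
      ∑ i ∈ Finset.range (p - 1), β i * ((p - 1).choose i : ℤ_[p]) * (t : ℤ_[p]) ^ (p - 1 - i) := by
  have hQ : ((p - 1 : ℕ) : ℚ) * ∑ k ∈ Finset.Ico 1 (t + 1), (k : ℚ) ^ (p - 2) =
      ∑ i ∈ Finset.range (p - 1), bernoulli' i * ((p - 1).choose i : ℚ) * (t : ℚ) ^ (p - 1 - i) := by
    rw [sum_Ico_pow, show p - 2 + 1 = p - 1 by omega, Finset.mul_sum]
    refine Finset.sum_congr rfl fun i _ => ?_
    have h1 : ((p - 2 : ℕ) : ℚ) + 1 = ((p - 1 : ℕ) : ℚ) := by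
      rw [← Nat.cast_succ]; congr 1; omega
    have h2 : ((p - 1 : ℕ) : ℚ) ≠ 0 := Nat.cast_ne_zero.2 (by omega)
    rw [h1]
    field_simp
  have h := congrArg (Rat.cast : ℚ → ℚ_[p]) hQ
  push_cast at h
  refine PadicInt.ext ?_
  simp only [PadicInt.coe_mul, PadicInt.coe_sum, PadicInt.coe_pow, PadicInt.coe_natCast]
  rw [h]
  refine Finset.sum_congr rfl fun i hi => ?_
  rw [Finset.mem_range] at hi
  rw [hβ i (by omega)]

theorem dvd_iff_toZMod_eq_zero {p : ℕ} [hp : Fact p.Prime] (x : ℤ_[p]) :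
    (p : ℤ_[p]) ∣ x ↔ PadicInt.toZMod x = 0 := by
  rw [← Ideal.mem_span_singleton, ← PadicInt.maximalIdeal_eq_span_p, ← PadicInt.ker_toZMod,
    RingHom.mem_ker]

/-- The reciprocal in `ℤ_[p]` of a natural number prime to `p`, extended by zero. -/
noncomputable def padicInv (p : ℕ) [Fact p.Prime] (l : ℕ) : ℤ_[p] :=
  if p ∣ l then 0 else Ring.inverse (l : ℤ_[p])

theorem isUnit_natCast_padicInt {p : ℕ} [hp : Fact p.Prime] {l : ℕ} (hl : ¬ p ∣ l) :
    IsUnit (l : ℤ_[p]) := by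
  rw [PadicInt.isUnit_iff, PadicInt.norm_natCast_eq_one_iff]
  exact (Nat.Prime.coprime_iff_not_dvd hp.out).2 hl

theorem isPrimeToInv_padicInv (p : ℕ) [hp : Fact p.Prime] : IsPrimeToInv p (padicInv p) where
  zero_of_dvd l hl := if_pos hl
  mul_eq_one l hl := by
    rw [padicInv, if_neg hl, Ring.mul_inverse_cancel _ (isUnit_natCast_padicInt hl)]

theorem dvd_blockCoeff_padicInv_sub {p : ℕ} [hp : Fact p.Prime] (hp7 : 7 < p)
    {β : ℕ → ℤ_[p]} (hβ : ∀ i, i + 1 < p → (β i : ℚ_[p]) = ((bernoulli' i : ℚ) : ℚ_[p])) :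
    ∀ k ∈ Finset.Icc 1 6,
      (p : ℤ_[p]) ∣ blockCoeff (padicInv p) p k - blockRatio k * β (p - 7) := by
  intro k hk
  rw [Finset.mem_Icc] at hk
  have h := (isPrimeToInv_padicInv p).map PadicInt.toZMod
  have h1 := blockCoeff_one_eq hp7 h (fun i => PadicInt.toZMod (β i)) fun t => by
    have := congrArg PadicInt.toZMod (sum_pow_eq_sum_bernoulli_padicInt (by omega) hβ t)
    simpa only [map_mul, map_sum, map_pow, map_natCast] using this
  rw [dvd_iff_toZMod_eq_zero, map_sub, ← blockCoeff_map,
    blockCoeff_eq_blockRatio_mul (by omega) h h1 hk.1 hk.2, map_mul, map_intCast, sub_self]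

theorem coe_padicInv {p : ℕ} [hp : Fact p.Prime] {l : ℕ} (hl : ¬ p ∣ l) :
    (padicInv p l : ℚ_[p]) = (l : ℚ_[p])⁻¹ := by
  have h := congrArg (fun x : ℤ_[p] => (x : ℚ_[p])) ((isPrimeToInv_padicInv p).mul_eq_one l hl)
  push_cast at h
  exact eq_inv_of_mul_eq_one_right h

theorem coe_coeff_mk_padicInv {p : ℕ} [hp : Fact p.Prime] (d N : ℕ) :
    ((PowerSeries.coeff N (PowerSeries.mk (padicInv p) ^ d) : ℤ_[p]) : ℚ_[p]) =
      ((recipSum p d N : ℚ) : ℚ_[p]) := by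
  have hprod (l : Fin d → ℕ) : ((∏ i, padicInv p (l i) : ℤ_[p]) : ℚ_[p]) =
      ∏ i, (padicInv p (l i) : ℚ_[p]) := map_prod PadicInt.Coe.ringHom _ _
  rw [coeff_mk_pow_eq_sum_antidiagonalTuple, recipSum, Finset.sum_filter, PadicInt.coe_sum]
  push_cast
  refine Finset.sum_congr rfl fun l _ => ?_
  rw [hprod]
  split_ifs with hl
  · rw [one_div, ← Finset.prod_inv_distrib, Rat.cast_prod]
    simp only [Rat.cast_inv, Rat.cast_natCast]
    exact Finset.prod_congr rfl fun i _ => coe_padicInv (hl i).2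
  · push Not at hl
    obtain ⟨i, hi⟩ := hl
    have hd : p ∣ l i := by
      rcases Nat.eq_zero_or_pos (l i) with h0 | h0
      · rw [h0]; exact dvd_zero p
      · exact hi h0
    refine Finset.prod_eq_zero (Finset.mem_univ i) ?_
    rw [(isPrimeToInv_padicInv p).zero_of_dvd _ hd, PadicInt.coe_zero]

theorem ratCongr_of_pow_dvd {p : ℕ} [hp : Fact p.Prime] {r : ℕ} {a b : ℚ} {x : ℤ_[p]}
    (hx : (x : ℚ_[p]) = ((a - b : ℚ) : ℚ_[p])) (hdvd : (p : ℤ_[p]) ^ r ∣ x) :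
    RatCongr p r a b := by
  obtain ⟨y, rfl⟩ := hdvd
  have hp0 : (p : ℚ) ^ r ≠ 0 := pow_ne_zero _ (Nat.cast_ne_zero.2 hp.out.ne_zero)
  refine ⟨(a - b) / (p : ℚ) ^ r, ?_, by field_simp⟩
  have hy : (((a - b) / (p : ℚ) ^ r : ℚ) : ℚ_[p]) = y := by
    have hp0' : (p : ℚ_[p]) ^ r ≠ 0 := pow_ne_zero _ (Nat.cast_ne_zero.2 hp.out.ne_zero)
    rw [Rat.cast_div, ← hx]
    push_cast
    field_simp
  have hn : ‖(((a - b) / (p : ℚ) ^ r : ℚ) : ℚ_[p])‖ ≤ 1 := by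
    rw [hy]; exact y.2
  have hu := PadicInt.isUnit_den _ hn
  rw [PadicInt.isUnit_iff, PadicInt.norm_natCast_eq_one_iff] at hu
  exact (Nat.Prime.coprime_iff_not_dvd hp.out).1 hu

theorem theorem1 (p m r : ℕ) (hp : p.Prime) (hp7 : 7 < p) (hm : 0 < m) (hpm : ¬ p ∣ m)
    (hr : 0 < r) :
    (r = 1 →
      RatCongr p 1 (recipSum p 7 (m * p))
        (-(504 * (m : ℚ) + 210 * (m : ℚ) ^ 3 + 6 * (m : ℚ) ^ 5) * bernoulli (p - 7))) ∧
    (2 ≤ r →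
      RatCongr p r (recipSum p 7 (m * p ^ r))
        (-((Nat.factorial 7 : ℚ) / 10) * (m : ℚ) * (p : ℚ) ^ (r - 1) * bernoulli (p - 7))) := by
  have : Fact p.Prime := ⟨hp⟩
  obtain ⟨β, hβ⟩ := exists_padicInt_bernoulli' p
  -- `bernoulli` and `bernoulli'` differ only at index `1`, which would need `p = 8`.
  have hne : p - 7 ≠ 1 := by
    intro h8
    have : p = 8 := by omega
    rw [this] at hp
    exact absurd hp (by norm_num)
  have hb := dvd_blockCoeff_padicInv_sub hp7 hβ
  have hβ7 := hβ (p - 7) (by omega)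
  rw [bernoulli_eq_bernoulli'_of_ne_one hne]
  constructor
  · intro _
    refine ratCongr_of_pow_dvd ?_
      ((pow_one (p : ℤ_[p])).symm ▸ dvd_coeff_mk_pow_seven hp (isPrimeToInv_padicInv p) hb m)
    have hn (k : ℕ) [k.AtLeastTwo] : ((OfNat.ofNat k : ℤ_[p]) : ℚ_[p]) = OfNat.ofNat k :=
      map_ofNat PadicInt.Coe.ringHom k
    push_cast
    rw [coe_coeff_mk_padicInv, hβ7, hn, hn, hn]
  · intro hr2
    obtain ⟨n, rfl⟩ := Nat.exists_eq_add_of_le' hr2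
    refine ratCongr_of_pow_dvd ?_
      (pow_dvd_coeff_mk_pow_seven hp hp7 (isPrimeToInv_padicInv p) hb n m)
    have hn : ((504 : ℤ_[p]) : ℚ_[p]) = 504 := map_ofNat PadicInt.Coe.ringHom 504
    push_cast
    rw [coe_coeff_mk_padicInv, hβ7, hn, show Nat.factorial 7 = 5040 by decide]
    push_cast
    ring
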